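/- For a finite group $G$ and integers $(a_g)_{g\in G}$ let $\mathscr{D}_G\big((a_g)_{g\in G}\big)=\det\big(a_{gh^{-1}}\big)_{g,h\in G}$ (rows indexed by $g$, columns by $h$) be the integer group determinant. Let $H_3$ be the Heisenberg group over $\mathbb{Z}/3\mathbb{Z}$, i.e. the group of order $27$ of matrices $\begin{pmatrix}1&a&c\\0&1&b\\0&0&1\end{pmatrix}$ with $a,b,c\in\mathbb{Z}/3\mathbb{Z}$ under matrix multiplication, and let $\mathscr{S}(H_3)=\{\mathscr{D}_{H_3}((a_g)_{g\in H_3}) : a_g\in\mathbb{Z}\text{ for all }g\in H_3\}$. Let $\mathscr{S}_1(H_3)$ be the set of elements of $\mathscr{S}(H_3)$ that are coprime to $3$, and $\mathscr{S}_0(H_3)$ the set of elements of $\mathscr{S}(H_3)$ that are multiples of $3$. Then $$\mathscr{S}_1(H_3)=\{m\in\mathbb{Z} : m\equiv\pm1 \bmod 27\},\qquad \mathscr{S}_0(H_3)=3^{12}\mathbb{Z}.$$ -/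

import Mathlib

/-!
The Fourier transform over the centre and over the abelianization of the Heisenberg group gives
`D = A * N ^ 3`. Here `A` is the group determinant over `(ℤ/3)²` of the push-forward of the
coefficients, and `N` is the norm from `ℤ[ω]` of the determinant of a `3 × 3` matrix, the value at
the coefficients of the representation with central character `ω`. Let `u` be the cubic form
`∑ b x ^ 3 - 3 * ∑ b p * b q * b r` of the push-forward `b`, the second sum being over the affine
lines `{p, q, r}` of `𝔽₃²`. Then `A ≡ u ^ 3` mod `27`, and since `ω ≡ 1` modulo the prime `ω - 1`
above `3`, `N ≡ u ^ 2` mod `9`. So `D ≡ u ^ 9` mod `27`, which leaves only `0` and `±1`.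

If `3 ∣ D`, then `3 ∣ u`, hence `9 ∣ N` and `3 ∣ ∑ b x`. The latter makes all nine Fourier
coefficients of `b` divisible by `ω - 1`, and those vanishing to second order include a line through
the origin, so that `(ω - 1) ^ 12 = 3 ^ 6` divides `A`, and `3 ^ 12 ∣ D`.

Conversely, adding a constant `m` to all coefficients multiplies `D` by `(s + 27 * m) / s`, where
`s` is their sum. Starting from the identity this gives `1 + 27 * m`, and starting from elements
with `s = 3 * r` and `D = 3 ^ 12 * r` it gives `3 ^ 12 * (r + 9 * m)`.
-/

/-- The Heisenberg group over `R`: the subgroup of `SL₃(R)` consisting of the matrices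
`(1, a, c; 0, 1, b; 0, 0, 1)` with `a, b, c ∈ R`. -/
def heisenberg (R : Type*) [CommRing R] : Subgroup (Matrix.SpecialLinearGroup (Fin 3) R) where
  carrier := {g | ∃ a b c : R, (g : Matrix (Fin 3) (Fin 3) R) = !![1, a, c; 0, 1, b; 0, 0, 1]}
  one_mem' := ⟨0, 0, 0, by ext i j; fin_cases i <;> fin_cases j <;> simp⟩
  mul_mem' := by
    rintro g h ⟨a, b, c, hg⟩ ⟨a', b', c', hh⟩
    refine ⟨a' + a, b' + b, c' + a * b' + c, ?_⟩
    rw [Matrix.SpecialLinearGroup.coe_mul, hg, hh]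
    ext i j
    fin_cases i <;> fin_cases j <;> simp [Matrix.mul_apply, Fin.sum_univ_three]
  inv_mem' := by
    rintro g ⟨a, b, c, hg⟩
    refine ⟨-a, -b, a * b - c, ?_⟩
    rw [Matrix.SpecialLinearGroup.coe_inv, hg, Matrix.adjugate_fin_three]
    ext i j
    fin_cases i <;> fin_cases j <;> simp

/-- Elements of the Heisenberg group are given by their three entries `a, b, c`. -/
def heisenbergEquiv (R : Type*) [CommRing R] : heisenberg R ≃ R × R × R where
  toFun g := (g.1.1 0 1, g.1.1 1 2, g.1.1 0 2)
  invFun t := ⟨⟨!![1, t.1, t.2.2; 0, 1, t.2.1; 0, 0, 1], by simp [Matrix.det_fin_three]⟩,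
    t.1, t.2.1, t.2.2, rfl⟩
  left_inv := by
    rintro ⟨g, a, b, c, hg⟩
    apply Subtype.ext
    apply Subtype.ext
    change _ = (g : Matrix (Fin 3) (Fin 3) R)
    simp [hg]
  right_inv t := by simp

instance heisenbergFintype (R : Type*) [CommRing R] [Fintype R] : Fintype (heisenberg R) :=
  Fintype.ofEquiv (R × R × R) (heisenbergEquiv R).symm

instance heisenbergDecidableEq (R : Type*) [CommRing R] [DecidableEq R] :
    DecidableEq (heisenberg R) :=
  (heisenbergEquiv R).decidableEq

/-- The group determinant `det (a_{g h⁻¹})`, rows indexed by `g` and columns by `h`,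
of a family of integers `(a_g)` indexed by a finite group `G`. -/
def groupDet (G : Type*) [Group G] [Fintype G] [DecidableEq G] (a : G → ℤ) : ℤ :=
  (Matrix.of fun g h : G => a (g * h⁻¹)).det

/-- The set of all integer group determinants of `G`. -/
def groupDetValues (G : Type*) [Group G] [Fintype G] [DecidableEq G] : Set ℤ :=
  {m | ∃ a : G → ℤ, groupDet G a = m}

/-- The integer group determinants of `G` that are multiples of `p`. -/
def groupDetValuesZero (p : ℕ) (G : Type*) [Group G] [Fintype G] [DecidableEq G] : Set ℤ :=
  {m | m ∈ groupDetValues G ∧ (p : ℤ) ∣ m}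

/-- The integer group determinants of `G` that are coprime to `p`. -/
def groupDetValuesOne (p : ℕ) (G : Type*) [Group G] [Fintype G] [DecidableEq G] : Set ℤ :=
  {m | m ∈ groupDetValues G ∧ IsCoprime m (p : ℤ)}

open Matrix
open scoped Kronecker

theorem mul_det_add_const {n K : Type*} [Fintype n] [DecidableEq n] [Nonempty n] [Field K]
    {M : Matrix n n K} {s : K} (hM : M *ᵥ 1 = fun _ => s) (m : K) :
    s * (M + of fun _ _ => m).det = (s + Fintype.card n * m) * M.det := by
  obtain rfl | hs := eq_or_ne s 0
  · have det_eq_zero : M.det = 0 := exists_mulVec_eq_zero_iff.mp ⟨1, one_ne_zero, hM⟩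
    rw [det_eq_zero, zero_mul, mul_zero]
  · have factor : M + of (fun _ _ => m) =
        M * (1 + replicateCol Unit (1 : n → K) * replicateRow Unit fun _ => m / s) := by
      rw [mul_add, mul_one, ← Matrix.mul_assoc, ← replicateCol_mulVec, hM]
      congr 1
      ext i j
      simp [mul_apply, mul_div_cancel₀ _ hs]
    rw [factor, det_mul, det_one_add_replicateCol_mul_replicateRow]
    simp only [dotProduct_one, Finset.sum_const, Finset.card_univ, nsmul_eq_mul]
    field_simp

section GroupDet

variable {G : Type*} [Group G] [Fintype G] [DecidableEq G]

theorem groupDet_neg (a : G → ℤ) : groupDet G (-a) = (-1) ^ Fintype.card G * groupDet G a :=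
  det_neg _

theorem neg_mem_groupDetValues (hG : Odd (Fintype.card G)) {m : ℤ} (hm : m ∈ groupDetValues G) :
    -m ∈ groupDetValues G := by
  obtain ⟨a, rfl⟩ := hm
  exact ⟨-a, by rw [groupDet_neg, hG.neg_one_pow, neg_one_mul]⟩

theorem sum_mul_groupDet_add_const (a : G → ℤ) (m : ℤ) :
    (∑ g, a g) * groupDet G (fun g => a g + m) =
      (∑ g, a g + Fintype.card G * m) * groupDet G a := by
  have row_sum : (of fun g h : G => (a (g * h⁻¹) : ℚ)) *ᵥ 1 = fun _ => ((∑ g, a g : ℤ) : ℚ) := by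
    ext g
    simp only [mulVec, dotProduct_one, of_apply, Int.cast_sum]
    exact Fintype.sum_equiv ((Equiv.inv G).trans (Equiv.mulLeft g)) _ _ fun _ => rfl
  have := mul_det_add_const row_sum m
  have cast_groupDet (b : G → ℤ) : (groupDet G b : ℚ) = (of fun g h : G => (b (g * h⁻¹) : ℚ)).det :=
    Int.cast_det _
  have shift : (of fun g h : G => (a (g * h⁻¹) : ℚ)) + of (fun _ _ => (m : ℚ)) =
      of fun g h : G => ((a (g * h⁻¹) + m : ℤ) : ℚ) := by
    ext
    simp
  rw [shift, ← cast_groupDet a, ← cast_groupDet fun g => a g + m] at this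
  exact_mod_cast this

theorem one_add_card_mul_mem_groupDetValues (m : ℤ) :
    1 + Fintype.card G * m ∈ groupDetValues G := by
  refine ⟨fun g => (Pi.single 1 1 : G → ℤ) g + m, ?_⟩
  have det_one : groupDet G (Pi.single 1 1) = 1 := by
    rw [groupDet, ← Matrix.det_one (n := G)]
    congr 1
    ext g h
    simp [Matrix.one_apply, Pi.single_apply, mul_inv_eq_one]
  simpa [det_one] using sum_mul_groupDet_add_const (Pi.single 1 1 : G → ℤ) m

end GroupDet

section Fourier

variable {R : Type*} [CommRing R] [IsDomain R]

theorem det_blockCirculant {Z n : Type*} [CommRing Z] [Fintype Z] [DecidableEq Z]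
    [Fintype n] [DecidableEq n] {ψ : AddChar Z R} (hψ : ψ.IsPrimitive)
    (hZ : (Fintype.card Z : R) ≠ 0) (N : n → n → Z → R) :
    (of fun x y : n × Z => N x.1 y.1 (x.2 - y.2)).det =
      ∏ k, (of fun i j => ∑ c, N i j c * ψ (k * c)).det := by
  set F : Matrix Z Z R := of fun c k => ψ (-(k * c)) with hF
  have orthogonality : F * (of fun k c => ψ (k * c)) = (Fintype.card Z : R) • 1 := by
    ext c c'
    calc ∑ k, ψ (-(k * c)) * ψ (k * c') = ∑ k, ψ (k * (c' - c)) := by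
          simp only [← AddChar.map_add_eq_mul]
          exact Finset.sum_congr rfl fun k _ => congrArg ψ (by ring)
      _ = ((Fintype.card Z : R) • (1 : Matrix Z Z R)) c c' := by
          simp [AddChar.sum_mulShift _ hψ, sub_eq_zero, one_apply, eq_comm]
  have det_F : F.det ≠ 0 := by
    refine left_ne_zero_of_mul (b := (of fun k c => ψ (k * c)).det) ?_
    rw [← det_mul, orthogonality, det_smul, det_one, mul_one]
    exact pow_ne_zero _ hZ
  have det_kron : ((1 : Matrix n n R) ⊗ₖ F).det ≠ 0 := by
    rw [det_kronecker, det_one, one_pow, one_mul]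
    exact pow_ne_zero _ det_F
  have intertwining : of (fun x y : n × Z => N x.1 y.1 (x.2 - y.2)) * ((1 : Matrix n n R) ⊗ₖ F) =
      ((1 : Matrix n n R) ⊗ₖ F) *
        blockDiagonal fun k => of fun i j => ∑ c, N i j c * ψ (k * c) := by
    ext ⟨i, c⟩ ⟨j, k⟩
    calc _ = ∑ c', N i j (c - c') * ψ (-(k * c')) := by
          simp [mul_apply, Fintype.sum_prod_type, one_apply, hF]
      _ = ∑ t, ψ (-(k * c)) * (N i j t * ψ (k * t)) := by
          rw [← Equiv.sum_comp (Equiv.subLeft c)]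
          refine Finset.sum_congr rfl fun t _ => ?_
          rw [Equiv.subLeft_apply, sub_sub_cancel, mul_left_comm, ← AddChar.map_add_eq_mul]
          congr 2
          ring
      _ = _ := by
          simp [mul_apply, Fintype.sum_prod_type, one_apply, blockDiagonal_apply, hF,
            Finset.mul_sum]
  rw [← det_blockDiagonal]
  refine mul_left_cancel₀ det_kron ?_
  rw [mul_comm, ← det_mul, intertwining, det_mul]

theorem groupDet_multiplicative_eq_prod {Z : Type*} [CommRing Z] [Fintype Z] [DecidableEq Z]
    {ψ : AddChar Z R} (hψ : ψ.IsPrimitive) (hZ : (Fintype.card Z : R) ≠ 0)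
    (f : Multiplicative Z → ℤ) :
    (groupDet (Multiplicative Z) f : R) = ∏ k, ∑ c, (f (.ofAdd c) : R) * ψ (k * c) := by
  let e : Multiplicative Z ≃ Unit × Z := Multiplicative.toAdd.trans (Equiv.punitProd Z).symm
  rw [groupDet, Int.cast_det, ← det_reindex_self e]
  refine Eq.trans ?_ ((det_blockCirculant hψ hZ
    fun (_ _ : Unit) c => (f (.ofAdd c) : R)).trans ?_)
  · congr 1
    ext x y
    simp [e, sub_eq_add_neg]
  · simp only [det_unique, of_apply]

end Fourier

section Heisenberg

variable {S : Type*} [CommRing S] [Fintype S] [DecidableEq S] {R : Type*} [CommRing R]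

/-- The coefficients of the image of `∑ v g • g` in the group ring of the quotient `S × S` of the
Heisenberg group by the matrices with `a = b = 0`. -/
def centralSum (v : S × S × S → ℤ) (x : S × S) : ℤ := ∑ c, v (x.1, x.2, c)

/-- The partial Fourier transform of `v` along the centre of the Heisenberg group. -/
def centralTransform (ψ : AddChar S R) (v : S × S × S → ℤ) (x : S × S) : R :=
  ∑ c, (v (x.1, x.2, c) : R) * ψ c

/-- The kernel on `S × S`, with rows and columns indexed by the pairs `(b, a)`, through which
`∑ v g • g` acts on the functions on the Heisenberg group with central character `ψ`. -/
def centralBlock (ψ : AddChar S R) (v : S × S × S → ℤ) : Matrix (S × S) (S × S) R :=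
  of fun x y => centralTransform ψ v (x.2 - y.2, x.1 - y.1) * ψ ((x.2 - y.2) * y.1)

/-- The image of `∑ v g • g` under the Schrödinger representation of the Heisenberg group, on the
functions on `S` and with central character `ψ`. -/
def schrodinger (ψ : AddChar S R) (v : S × S × S → ℤ) : Matrix S S R :=
  of fun r s => ∑ t, centralTransform ψ v (t, r - s) * ψ (s * t)

theorem det_centralBlock_one (v : S × S × S → ℤ) :
    (centralBlock (1 : AddChar S R) v).det =
      groupDet (Multiplicative (S × S)) (centralSum v ∘ Multiplicative.toAdd) := by
  rw [groupDet, Int.cast_det,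
    ← det_submatrix_equiv_self ((Equiv.prodComm S S).trans Multiplicative.ofAdd)]
  congr 1
  ext x y
  simp [centralBlock, centralTransform, centralSum, sub_eq_add_neg]

theorem det_schrodinger_twist (ψ : AddChar S R) (v : S × S × S → ℤ) (m : S) :
    (of fun r s => ∑ t, centralTransform ψ v (t, r - s) * ψ (t * s) * ψ (m * t)).det =
      (schrodinger ψ v).det := by
  rw [← det_submatrix_equiv_self (Equiv.addRight m) (schrodinger ψ v)]
  congr 1
  ext r s
  simp [schrodinger, add_mul, AddChar.map_add_eq_mul, mul_assoc, mul_comm s]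

theorem mem_groupDetValues_heisenberg {m : ℤ} :
    m ∈ groupDetValues (heisenberg S) ↔
      ∃ v : S × S × S → ℤ, groupDet (heisenberg S) (v ∘ heisenbergEquiv S) = m :=
  ((heisenbergEquiv S).arrowCongr (Equiv.refl ℤ)).exists_congr_left.trans (by rfl)

variable [IsDomain R] {ψ : AddChar S R}

theorem det_centralBlock (hψ : ψ.IsPrimitive) (hS : (Fintype.card S : R) ≠ 0)
    (v : S × S × S → ℤ) :
    (centralBlock ψ v).det = (schrodinger ψ v).det ^ Fintype.card S := by
  calc (centralBlock ψ v).det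
      = ∏ m, (of fun r s => ∑ t, centralTransform ψ v (t, r - s) * ψ (t * s) * ψ (m * t)).det :=
        det_blockCirculant hψ hS fun r s t => centralTransform ψ v (t, r - s) * ψ (t * s)
    _ = (schrodinger ψ v).det ^ Fintype.card S := by
        simp only [det_schrodinger_twist, Finset.prod_const, Finset.card_univ]

theorem groupDet_heisenberg_eq_prod_centralBlock (hψ : ψ.IsPrimitive)
    (hS : (Fintype.card S : R) ≠ 0) (v : S × S × S → ℤ) :
    (groupDet (heisenberg S) (v ∘ heisenbergEquiv S) : R) =
      ∏ k, (centralBlock (ψ.mulShift k) v).det := by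
  let e : heisenberg S ≃ (S × S) × S :=
    (heisenbergEquiv S).trans
      ((Equiv.prodAssoc _ _ _).symm.trans ((Equiv.prodComm _ _).prodCongr (Equiv.refl _)))
  let N (x y : S × S) (c : S) : R := v (x.2 - y.2, x.1 - y.1, c - (x.2 - y.2) * y.1)
  have transform (k : S) : of (fun x y => ∑ c, N x y c * ψ (k * c)) =
      centralBlock (ψ.mulShift k) v := by
    ext x y
    rw [of_apply, ← Equiv.sum_comp (Equiv.addRight ((x.2 - y.2) * y.1))]
    simp [N, centralBlock, centralTransform, mul_add, AddChar.map_add_eq_mul, mul_assoc,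
      Finset.sum_mul]
  simp only [← transform]
  rw [groupDet, Int.cast_det, ← det_reindex_self e, ← det_blockCirculant hψ hS]
  congr 1
  ext ⟨⟨b, a⟩, c⟩ ⟨⟨b', a'⟩, c'⟩
  simp [e, N, heisenbergEquiv, adjugate_fin_three, mul_apply, Fin.sum_univ_three]
  ring_nf

theorem groupDet_heisenberg_eq_mul_prod {F : Type*} [Field F] [Fintype F] [DecidableEq F]
    {ψ : AddChar F R} (hψ : ψ.IsPrimitive) (hF : (Fintype.card F : R) ≠ 0) (v : F × F × F → ℤ) :
    (groupDet (heisenberg F) (v ∘ heisenbergEquiv F) : R) =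
      groupDet (Multiplicative (F × F)) (centralSum v ∘ Multiplicative.toAdd) *
        ∏ k ∈ Finset.univ.erase 0, (schrodinger (ψ.mulShift k) v).det ^ Fintype.card F := by
  rw [groupDet_heisenberg_eq_prod_centralBlock hψ hF,
    ← Finset.mul_prod_erase _ _ (Finset.mem_univ 0), AddChar.mulShift_zero, det_centralBlock_one]
  refine congrArg _ (Finset.prod_congr rfl fun k hk => det_centralBlock ?_ hF v)
  exact AddChar.IsPrimitive.of_ne_one (hψ (Finset.ne_of_mem_erase hk))

end Heisenberg

theorem three_mul_dvd_pow_three_sub_pow_three {R : Type*} [CommRing R] {p x y : R}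
    (hp : 3 ∣ p ^ 2) (h : p ∣ x - y) : 3 * p ∣ x ^ 3 - y ^ 3 := by
  obtain ⟨q, hq⟩ := hp
  obtain ⟨t, ht⟩ := h
  refine ⟨t * (q * t ^ 2 + x * y), ?_⟩
  calc x ^ 3 - y ^ 3 = (x - y) * ((x - y) ^ 2 + 3 * (x * y)) := by ring
    _ = p * t * (p ^ 2 * t ^ 2 + 3 * (x * y)) := by rw [ht, mul_pow]
    _ = _ := by rw [hq]; ring

section CubicForm

variable {R : Type*} [CommRing R]

theorem sum_zmod_three {M : Type*} [AddCommMonoid M] (f : ZMod 3 → M) :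
    ∑ t, f t = f 0 + f 1 + f 2 := Fin.sum_univ_three f

theorem prod_zmod_three {M : Type*} [CommMonoid M] (f : ZMod 3 → M) :
    ∏ t, f t = f 0 * f 1 * f 2 := Fin.prod_univ_three f

theorem det_zmod_three (M : Matrix (ZMod 3) (ZMod 3) R) :
    M.det = M 0 0 * M 1 1 * M 2 2 - M 0 0 * M 1 2 * M 2 1 - M 0 1 * M 1 0 * M 2 2 +
      M 0 1 * M 1 2 * M 2 0 + M 0 2 * M 1 0 * M 2 1 - M 0 2 * M 1 1 * M 2 0 :=
  det_fin_three M

theorem det_of_sub (f : ZMod 3 → ZMod 3 → R) :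
    (of fun r s => f (r - s) s).det = ∑ d, ∏ s, f d s - ∑ s, ∏ d, f d (s + d) := by
  simp only [det_zmod_three, sum_zmod_three, prod_zmod_three, of_apply]
  reduce_mod_char
  ring

/-- The sum over the twelve affine lines of `𝔽₃²` of the product of `c` along the line, where the
lines `{(i + m * y, y)}` are weighted by `w m` and the lines `{(x, y) : x ∈ 𝔽₃}` by `1`. -/
def lineSum (w : ZMod 3 → R) (c : ZMod 3 × ZMod 3 → R) : R :=
  ∑ y, ∏ x, c (x, y) + ∑ m, w m * ∑ i, ∏ y, c (i + m * y, y)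

/-- The cubic form on functions on `𝔽₃²` that computes the determinants `det (schrodinger ψ v)`;
its weights `w` come from the central character `ψ`. -/
def cubicForm (w : ZMod 3 → R) (c : ZMod 3 × ZMod 3 → R) : R :=
  ∑ x, c x ^ 3 - 3 * lineSum w c

variable {ψ : AddChar (ZMod 3) R} (hψ : ∑ t, ψ t = 0)
include hψ

theorem prod_fourier (x : ZMod 3 → R) :
    ∏ s, ∑ t, x t * ψ (s * t) = ∑ t, x t ^ 3 - 3 * ∏ t, x t := by
  have h0 : ψ 0 = 1 := ψ.map_zero_eq_one
  have h2 : ψ 2 = ψ 1 ^ 2 := by rw [← AddChar.map_nsmul_eq_pow]; rfl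
  have h4 : ψ (2 * 2) = ψ 1 := rfl
  rw [sum_zmod_three, h0, h2] at hψ
  simp only [sum_zmod_three, prod_zmod_three, zero_mul, one_mul, mul_zero, mul_one, h0, h2, h4]
  clear h0 h2 h4
  grind

theorem sum_prod_fourier (x : ZMod 3 → ZMod 3 → R) :
    ∑ s, ∏ d, ∑ t, x d t * ψ ((s + d) * t) = 3 * ∑ m, ψ (-m) * ∑ i, ∏ d, x d (i + m * d) := by
  have h0 : ψ 0 = 1 := ψ.map_zero_eq_one
  have h2 : ψ 2 = ψ 1 ^ 2 := by rw [← AddChar.map_nsmul_eq_pow]; rfl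
  rw [sum_zmod_three, h0, h2] at hψ
  simp only [sum_zmod_three, prod_zmod_three]
  reduce_mod_char
  rw [h0, h2]
  clear h0 h2
  grind

theorem det_schrodinger (v : ZMod 3 × ZMod 3 × ZMod 3 → ℤ) :
    (schrodinger ψ v).det = cubicForm (fun m => ψ (-m)) (centralTransform ψ v) := by
  refine (det_of_sub fun d s => ∑ t, centralTransform ψ v (t, d) * ψ (s * t)).trans ?_
  rw [sum_prod_fourier hψ fun d t => centralTransform ψ v (t, d)]
  simp only [prod_fourier hψ, cubicForm, lineSum, Fintype.sum_prod_type_right,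
    Finset.sum_sub_distrib, ← Finset.mul_sum, mul_add, sub_sub]

omit hψ

theorem dvd_lineSum_sub_lineSum {p : R} {w w' : ZMod 3 → R} {c c' : ZMod 3 × ZMod 3 → R}
    (hw : ∀ m, p ∣ w m - w' m) (hc : ∀ x, p ∣ c x - c' x) : p ∣ lineSum w c - lineSum w' c' := by
  simp only [← Ideal.Quotient.eq_zero_iff_dvd, map_sub, sub_eq_zero] at *
  simp only [lineSum, map_add, map_sum, map_mul, map_prod, hw, hc]

theorem three_mul_dvd_cubicForm_sub_cubicForm {p : R} (hp : 3 ∣ p ^ 2) {w w' : ZMod 3 → R}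
    {c c' : ZMod 3 × ZMod 3 → R} (hw : ∀ m, p ∣ w m - w' m) (hc : ∀ x, p ∣ c x - c' x) :
    3 * p ∣ cubicForm w c - cubicForm w' c' := by
  rw [cubicForm, cubicForm, sub_sub_sub_comm, ← mul_sub, ← Finset.sum_sub_distrib]
  exact dvd_sub
    (Finset.dvd_sum fun x _ => three_mul_dvd_pow_three_sub_pow_three hp (hc x))
    (mul_dvd_mul_left 3 (dvd_lineSum_sub_lineSum hw hc))

end CubicForm

section AbelianPart

variable {R : Type*} [CommRing R]

/-- The coefficient at `n` of the product `x 0 * x 1 * x 2` in the group ring of `ℤ/3`. -/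
def tripleConv (x : ZMod 3 → ZMod 3 → R) (n : ZMod 3) : R :=
  ∑ i, ∑ j, x 0 i * x 1 j * x 2 (n - i - j)

theorem prod_sum_mul_addChar (ψ : AddChar (ZMod 3) R) (x : ZMod 3 → ZMod 3 → R) (s : ZMod 3) :
    ∏ d, ∑ t, x d t * ψ (s * t) = ∑ n, tripleConv x n * ψ (s * n) := by
  have h3 : ψ s ^ 3 = 1 := by
    rw [← AddChar.map_nsmul_eq_pow, nsmul_eq_mul]
    reduce_mod_char
    exact ψ.map_zero_eq_one
  have h2 : ψ (s * 2) = ψ s ^ 2 := by rw [← AddChar.map_nsmul_eq_pow, nsmul_eq_mul, mul_comm]; rfl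
  simp only [tripleConv, sum_zmod_three, prod_zmod_three, h2, mul_zero, mul_one,
    AddChar.map_zero_eq_one]
  reduce_mod_char
  clear h2
  grind

theorem tripleConv_const_zero (x : ZMod 3 → R) :
    tripleConv (fun _ => x) 0 = ∑ t, x t ^ 3 + 6 * ∏ t, x t := by
  simp only [tripleConv, sum_zmod_three, prod_zmod_three]
  reduce_mod_char
  ring

theorem three_dvd_tripleConv_const (x : ZMod 3 → R) {n : ZMod 3} (hn : n ≠ 0) :
    3 ∣ tripleConv (fun _ => x) n := by
  obtain rfl | rfl : n = 1 ∨ n = 2 := by decide +revert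
  · refine ⟨x 0 ^ 2 * x 1 + x 1 ^ 2 * x 2 + x 2 ^ 2 * x 0, ?_⟩
    simp only [tripleConv, sum_zmod_three]
    reduce_mod_char
    ring
  · refine ⟨x 0 ^ 2 * x 2 + x 1 ^ 2 * x 0 + x 2 ^ 2 * x 1, ?_⟩
    simp only [tripleConv, sum_zmod_three]
    reduce_mod_char
    ring

theorem tripleConv_zero (x : ZMod 3 → ZMod 3 → R) :
    tripleConv x 0 = ∑ m, ∑ i, ∏ d, x d (i + m * d) := by
  simp only [tripleConv, sum_zmod_three, prod_zmod_three]
  reduce_mod_char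
  ring

/-- The coefficients of the norm of `c` from the group ring of `(ℤ/3)²` to that of its first
factor. -/
def partialNorm (c : ZMod 3 × ZMod 3 → R) (n : ZMod 3) : R :=
  ∑ y, tripleConv (fun _ x => c (x, y)) n - 3 * tripleConv (fun y x => c (x, y)) n

theorem nine_dvd_partialNorm_zero_sub_cubicForm (c : ZMod 3 × ZMod 3 → R) :
    9 ∣ partialNorm c 0 - cubicForm 1 c := by
  refine ⟨∑ y, ∏ x, c (x, y), ?_⟩
  rw [partialNorm, tripleConv_zero]
  simp only [tripleConv_const_zero, cubicForm, lineSum, Finset.sum_add_distrib, ← Finset.mul_sum,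
    Fintype.sum_prod_type_right, Pi.one_apply, one_mul]
  ring

theorem three_dvd_partialNorm (c : ZMod 3 × ZMod 3 → R) {n : ZMod 3} (hn : n ≠ 0) :
    3 ∣ partialNorm c n :=
  dvd_sub (Finset.dvd_sum fun _ _ => three_dvd_tripleConv_const _ hn) (dvd_mul_right _ _)

variable {ψ : AddChar (ZMod 3) R} (hψ : ∑ t, ψ t = 0)
include hψ

theorem prod_fourier_eq_partialNorm (c : ZMod 3 × ZMod 3 → R) :
    ∏ k : ZMod 3 × ZMod 3, ∑ x, c x * (ψ (k.1 * x.1) * ψ (k.2 * x.2)) =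
      ∑ n, partialNorm c n ^ 3 - 3 * ∏ n, partialNorm c n := by
  rw [← prod_fourier hψ, Fintype.prod_prod_type]
  refine Finset.prod_congr rfl fun j _ => ?_
  calc ∏ k, ∑ x : ZMod 3 × ZMod 3, c x * (ψ (j * x.1) * ψ (k * x.2))
      = ∏ k, ∑ y, (∑ x, c (x, y) * ψ (j * x)) * ψ (k * y) := by
        simp only [Fintype.sum_prod_type_right, Finset.sum_mul, mul_assoc]
    _ = ∑ y, (∑ x, c (x, y) * ψ (j * x)) ^ 3 - 3 * ∏ y, ∑ x, c (x, y) * ψ (j * x) :=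
        prod_fourier hψ _
    _ = ∑ y, ∑ n, tripleConv (fun _ x => c (x, y)) n * ψ (j * n) -
          3 * ∑ n, tripleConv (fun y x => c (x, y)) n * ψ (j * n) := by
        simp only [← prod_sum_mul_addChar, Finset.prod_const]
        rfl
    _ = ∑ n, partialNorm c n * ψ (j * n) := by
        simp only [partialNorm, sub_mul, Finset.sum_mul, Finset.sum_sub_distrib, Finset.mul_sum,
          mul_assoc]
        rw [Finset.sum_comm]

theorem dvd_prod_fourier_sub_cubicForm_pow_three (c : ZMod 3 × ZMod 3 → R) :
    27 ∣ ∏ k : ZMod 3 × ZMod 3, ∑ x, c x * (ψ (k.1 * x.1) * ψ (k.2 * x.2)) -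
      cubicForm 1 c ^ 3 := by
  obtain ⟨y, hy⟩ := three_dvd_partialNorm c (n := 1) (by decide)
  obtain ⟨z, hz⟩ := three_dvd_partialNorm c (n := 2) (by decide)
  have main_term : 27 ∣ partialNorm c 0 ^ 3 - cubicForm 1 c ^ 3 := by
    have := three_mul_dvd_pow_three_sub_pow_three ⟨27, by norm_num⟩
      (nine_dvd_partialNorm_zero_sub_cubicForm c)
    rwa [show (3 * 9 : R) = 27 by norm_num] at this
  rw [prod_fourier_eq_partialNorm hψ]
  convert dvd_add main_term (dvd_mul_right 27 (y ^ 3 + z ^ 3 - partialNorm c 0 * y * z)) using 1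
  rw [sum_zmod_three, prod_zmod_three, hy, hz]
  ring

end AbelianPart

section ProductCharacter

variable {Z W R : Type*} [CommRing Z] [CommRing W] [CommRing R]

/-- The additive character `(z, w) ↦ ψ z * χ w` of the product ring `Z × W`. -/
def prodChar (ψ : AddChar Z R) (χ : AddChar W R) : AddChar (Z × W) R :=
  ψ.compAddMonoidHom (AddMonoidHom.fst Z W) * χ.compAddMonoidHom (AddMonoidHom.snd Z W)

theorem prodChar_isPrimitive {ψ : AddChar Z R} {χ : AddChar W R} (hψ : ψ.IsPrimitive)
    (hχ : χ.IsPrimitive) : (prodChar ψ χ).IsPrimitive := by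
  rintro ⟨a, b⟩ hab h
  obtain ha | hb : a ≠ 0 ∨ b ≠ 0 := by
    contrapose! hab
    simp [hab]
  · exact hψ ha (DFunLike.ext _ _ fun x => by simpa [prodChar] using DFunLike.congr_fun h (x, 0))
  · exact hχ hb (DFunLike.ext _ _ fun y => by simpa [prodChar] using DFunLike.congr_fun h (0, y))

end ProductCharacter

open scoped QuadraticAlgebra

/-- The ring `ℤ[ω]` of Eisenstein integers, where `ω ^ 2 = -1 - ω`. -/
abbrev EisensteinInt : Type := QuadraticAlgebra ℤ (-1) (-1)

namespace EisensteinInt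

theorem norm_eq (z : EisensteinInt) : z.norm = z.re ^ 2 - z.re * z.im + z.im ^ 2 := by
  rw [QuadraticAlgebra.norm_def]
  ring

theorem eq_zero_of_norm_eq_zero {z : EisensteinInt} (hz : z.norm = 0) : z = 0 := by
  have sum_squares : (2 * z.re - z.im) ^ 2 + 3 * z.im ^ 2 = 0 := by
    rw [norm_eq] at hz
    linear_combination 4 * hz
  have him : z.im = 0 := by nlinarith [sq_nonneg (2 * z.re - z.im)]
  have hre : z.re = 0 := by nlinarith
  exact QuadraticAlgebra.ext hre him

instance : NoZeroDivisors EisensteinInt where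
  eq_zero_or_eq_zero_of_mul_eq_zero {z w} h := by
    have : z.norm * w.norm = 0 := by rw [← map_mul, h, QuadraticAlgebra.norm_zero]
    exact (mul_eq_zero.mp this).imp eq_zero_of_norm_eq_zero eq_zero_of_norm_eq_zero

instance : IsDomain EisensteinInt := NoZeroDivisors.to_isDomain _

/-- The ramified prime `ω - 1` above `3`. -/
def lam : EisensteinInt := ω - 1

/-- The cubic character `t ↦ ω ^ t` of `ℤ/3`. -/
def cubicChar : AddChar (ZMod 3) EisensteinInt :=
  AddChar.zmodChar 3 (ζ := (ω : EisensteinInt)) (by decide)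

theorem cubicChar_isPrimitive : cubicChar.IsPrimitive :=
  AddChar.zmod_char_primitive_of_eq_one_only_at_zero 3 _ (by decide)

theorem sum_cubicChar : ∑ t, cubicChar t = 0 := by decide

theorem star_cubicChar (t : ZMod 3) : star (cubicChar t) = cubicChar (2 * t) := by decide +revert

theorem lam_dvd_cubicChar_sub_one (t : ZMod 3) : lam ∣ cubicChar t - 1 :=
  sub_one_dvd_pow_sub_one _ _

theorem lam_sq_dvd_cubicChar_sub (t : ZMod 3) : lam ^ 2 ∣ cubicChar t - 1 - t.val * lam :=
  ⟨if t = 2 then 1 else 0, by decide +revert⟩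

theorem lam_sq_dvd_three : lam ^ 2 ∣ 3 := ⟨-ω ^ 2, by decide⟩

theorem three_dvd_lam_sq : 3 ∣ lam ^ 2 := ⟨-ω, by decide⟩

theorem lam_pow_twelve : lam ^ 12 = ((3 ^ 6 : ℤ) : EisensteinInt) := by decide

theorem intCast_dvd_intCast {m n : ℤ} : (m : EisensteinInt) ∣ n ↔ m ∣ n :=
  QuadraticAlgebra.algebraMap_dvd_iff_dvd

theorem nine_dvd_norm_sub_sq {z : EisensteinInt} {u : ℤ} (h : 3 * lam ∣ z - u) :
    9 ∣ z.norm - u ^ 2 := by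
  obtain ⟨k, hk⟩ := h
  have hre : (3 * lam * k + u).re = u - 3 * (k.re + k.im) := by
    simp [lam]
    ring
  have him : (3 * lam * k + u).im = 3 * (k.re - 2 * k.im) := by
    simp [lam]
    ring
  refine ⟨3 * k.norm - u * k.re, ?_⟩
  rw [sub_eq_iff_eq_add.mp hk, norm_eq, norm_eq, hre, him]
  ring

theorem lam_sq_dvd_sum_mul_cubicChar_sub {ι : Type*} [Fintype ι] (b : ι → ℤ) (f : ι → ZMod 3) :
    lam ^ 2 ∣ ∑ x, (b x : EisensteinInt) * cubicChar (f x) -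
      ((∑ x, b x : ℤ) + (∑ x, b x * (f x).val : ℤ) * lam) := by
  push_cast
  rw [Finset.sum_mul, ← Finset.sum_add_distrib, ← Finset.sum_sub_distrib]
  refine Finset.dvd_sum fun x _ => ?_
  convert (lam_sq_dvd_cubicChar_sub (f x)).mul_left (b x : EisensteinInt) using 1
  ring

theorem lam_pow_dvd_sum_mul_cubicChar {ι : Type*} [Fintype ι] {b : ι → ℤ} (hb : 3 ∣ ∑ x, b x)
    (f : ι → ZMod 3) :
    lam ^ (if ∑ x, (b x : ZMod 3) * f x = 0 then 2 else 1) ∣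
      ∑ x, (b x : EisensteinInt) * cubicChar (f x) := by
  have lam_sq_dvd {n : ℤ} (hn : 3 ∣ n) : lam ^ 2 ∣ (n : EisensteinInt) :=
    lam_sq_dvd_three.trans (intCast_dvd_intCast.mpr hn)
  split_ifs with h
  · refine (dvd_iff_dvd_of_dvd_sub (lam_sq_dvd_sum_mul_cubicChar_sub b f)).mpr ?_
    refine dvd_add (lam_sq_dvd hb) ((lam_sq_dvd ?_).mul_right _)
    refine (ZMod.intCast_zmod_eq_zero_iff_dvd _ 3).mp ?_
    simpa using h
  · rw [pow_one]
    refine (dvd_iff_dvd_of_dvd_sub ((dvd_pow_self lam two_ne_zero).trans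
      (lam_sq_dvd_sum_mul_cubicChar_sub b f))).mpr ?_
    exact dvd_add ((dvd_pow_self lam two_ne_zero).trans (lam_sq_dvd hb)) (dvd_mul_left _ _)

end EisensteinInt

open EisensteinInt

theorem star_det_schrodinger (v : ZMod 3 × ZMod 3 × ZMod 3 → ℤ) :
    star (schrodinger cubicChar v).det = (schrodinger (cubicChar.mulShift 2) v).det := by
  rw [← starRingEnd_apply, RingHom.map_det]
  refine congrArg det (Matrix.ext fun r s => ?_)
  simp [schrodinger, centralTransform, starRingEnd_apply, star_cubicChar]

theorem groupDet_heisenberg_eq_mul_norm (v : ZMod 3 × ZMod 3 × ZMod 3 → ℤ) :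
    groupDet (heisenberg (ZMod 3)) (v ∘ heisenbergEquiv (ZMod 3)) =
      groupDet (Multiplicative (ZMod 3 × ZMod 3)) (centralSum v ∘ Multiplicative.toAdd) *
        (schrodinger cubicChar v).det.norm ^ 3 := by
  have erase_zero : (Finset.univ.erase 0 : Finset (ZMod 3)) = {1, 2} := by decide
  apply Int.cast_injective (α := EisensteinInt)
  rw [groupDet_heisenberg_eq_mul_prod cubicChar_isPrimitive (by simp [ZMod.card]), erase_zero,
    Finset.prod_pair (by decide), AddChar.mulShift_one, ← star_det_schrodinger, ← mul_pow,
    ← QuadraticAlgebra.algebraMap_norm_eq_mul_star, ZMod.card]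
  simp

theorem groupDet_eq_prod_fourier (b : ZMod 3 × ZMod 3 → ℤ) :
    (groupDet (Multiplicative (ZMod 3 × ZMod 3)) (b ∘ Multiplicative.toAdd) : EisensteinInt) =
      ∏ k : ZMod 3 × ZMod 3, ∑ x,
        (b x : EisensteinInt) * (cubicChar (k.1 * x.1) * cubicChar (k.2 * x.2)) :=
  groupDet_multiplicative_eq_prod
    (prodChar_isPrimitive cubicChar_isPrimitive cubicChar_isPrimitive) (by simp [ZMod.card]) _

theorem intCast_cubicForm_one (b : ZMod 3 × ZMod 3 → ℤ) :
    ((cubicForm 1 b : ℤ) : EisensteinInt) = cubicForm 1 fun x => (b x : EisensteinInt) := by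
  simp [cubicForm, lineSum]

theorem norm_det_schrodinger_modEq (v : ZMod 3 × ZMod 3 × ZMod 3 → ℤ) :
    (schrodinger cubicChar v).det.norm ≡ cubicForm 1 (centralSum v) ^ 2 [ZMOD 9] := by
  refine (Int.modEq_iff_dvd.mpr (nine_dvd_norm_sub_sq ?_)).symm
  rw [det_schrodinger sum_cubicChar, intCast_cubicForm_one]
  refine three_mul_dvd_cubicForm_sub_cubicForm three_dvd_lam_sq
    (fun m => lam_dvd_cubicChar_sub_one (-m)) fun x => ?_
  rw [centralTransform, centralSum, Int.cast_sum, ← Finset.sum_sub_distrib]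
  refine Finset.dvd_sum fun c _ => ?_
  rw [← mul_sub_one]
  exact (lam_dvd_cubicChar_sub_one c).mul_left _

theorem groupDet_modEq_cubicForm_pow_three (b : ZMod 3 × ZMod 3 → ℤ) :
    groupDet (Multiplicative (ZMod 3 × ZMod 3)) (b ∘ Multiplicative.toAdd) ≡
      cubicForm 1 b ^ 3 [ZMOD 27] := by
  refine (Int.modEq_iff_dvd.mpr (intCast_dvd_intCast.mp ?_)).symm
  push_cast
  rw [groupDet_eq_prod_fourier, intCast_cubicForm_one]
  exact dvd_prod_fourier_sub_cubicForm_pow_three sum_cubicChar _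

theorem pow_three_modEq_pow_three {n x y : ℤ} (hn : 3 ∣ n ^ 2) (h : x ≡ y [ZMOD n]) :
    x ^ 3 ≡ y ^ 3 [ZMOD 3 * n] :=
  Int.modEq_iff_dvd.mpr (three_mul_dvd_pow_three_sub_pow_three hn h.dvd)

theorem groupDet_heisenberg_modEq (v : ZMod 3 × ZMod 3 × ZMod 3 → ℤ) :
    groupDet (heisenberg (ZMod 3)) (v ∘ heisenbergEquiv (ZMod 3)) ≡
      cubicForm 1 (centralSum v) ^ 9 [ZMOD 27] := by
  rw [groupDet_heisenberg_eq_mul_norm,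
    show cubicForm 1 (centralSum v) ^ 9 =
      cubicForm 1 (centralSum v) ^ 3 * (cubicForm 1 (centralSum v) ^ 2) ^ 3 by ring]
  exact (groupDet_modEq_cubicForm_pow_three _).mul
    (pow_three_modEq_pow_three (by norm_num) (norm_det_schrodinger_modEq v))

theorem cubicForm_modEq_sum (w : ZMod 3 → ℤ) (b : ZMod 3 × ZMod 3 → ℤ) :
    cubicForm w b ≡ ∑ x, b x [ZMOD 3] := by
  rw [show (3 : ℤ) = (3 : ℕ) from rfl, ← ZMod.intCast_eq_intCast_iff]
  simp [cubicForm, ZMod.pow_card, show (3 : ZMod 3) = 0 from rfl]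

theorem pow_six_dvd_groupDet {b : ZMod 3 × ZMod 3 → ℤ} (hb : 3 ∣ ∑ x, b x) :
    3 ^ 6 ∣ groupDet (Multiplicative (ZMod 3 × ZMod 3)) (b ∘ Multiplicative.toAdd) := by
  let M : ZMod 3 × ZMod 3 := (∑ x, (b x : ZMod 3) * x.1, ∑ x, (b x : ZMod 3) * x.2)
  have twelve_le (M : ZMod 3 × ZMod 3) :
      12 ≤ ∑ k : ZMod 3 × ZMod 3, if k.1 * M.1 + k.2 * M.2 = 0 then 2 else 1 := by
    decide +revert
  have factor_dvd (k : ZMod 3 × ZMod 3) : lam ^ (if k.1 * M.1 + k.2 * M.2 = 0 then 2 else 1) ∣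
      ∑ x, (b x : EisensteinInt) * (cubicChar (k.1 * x.1) * cubicChar (k.2 * x.2)) := by
    convert lam_pow_dvd_sum_mul_cubicChar hb fun x => k.1 * x.1 + k.2 * x.2 using 3
    · simp only [M, mul_add, Finset.mul_sum, Finset.sum_add_distrib, mul_left_comm]
    · rw [AddChar.map_add_eq_mul]
  refine intCast_dvd_intCast.mp ?_
  rw [← lam_pow_twelve, groupDet_eq_prod_fourier]
  refine (pow_dvd_pow lam (twelve_le M)).trans ?_
  rw [← Finset.prod_pow_eq_pow_sum]
  exact Finset.prod_dvd_prod_of_dvd _ _ fun k _ => factor_dvd k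

theorem modEq_one_or_neg_one_of_mem_groupDetValues {m : ℤ}
    (hm : m ∈ groupDetValues (heisenberg (ZMod 3))) (h : ¬ 3 ∣ m) :
    m ≡ 1 [ZMOD 27] ∨ m ≡ -1 [ZMOD 27] := by
  obtain ⟨v, rfl⟩ := mem_groupDetValues_heisenberg.mp hm
  have det_modEq := groupDet_heisenberg_modEq v
  set u := cubicForm 1 (centralSum v)
  have pow_nine_modEq {w : ℤ} (hw : u ≡ w [ZMOD 3]) : u ^ 9 ≡ w ^ 9 [ZMOD 27] := by
    have := pow_three_modEq_pow_three (by norm_num)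
      (pow_three_modEq_pow_three (by norm_num) hw)
    simpa only [← pow_mul, Nat.reduceMul, Int.reduceMul] using this
  obtain hu | hu | hu : u ≡ 0 [ZMOD 3] ∨ u ≡ 1 [ZMOD 3] ∨ u ≡ -1 [ZMOD 3] := by
    simp only [Int.ModEq]
    lia
  · refine absurd ?_ h
    exact Int.modEq_zero_iff_dvd.mp
      ((det_modEq.trans (pow_nine_modEq hu)).of_dvd (by norm_num))
  · exact .inl (det_modEq.trans (pow_nine_modEq hu))
  · exact .inr (det_modEq.trans (pow_nine_modEq hu))

theorem pow_twelve_dvd_of_mem_groupDetValues {m : ℤ}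
    (hm : m ∈ groupDetValues (heisenberg (ZMod 3))) (h : 3 ∣ m) : 3 ^ 12 ∣ m := by
  obtain ⟨v, rfl⟩ := mem_groupDetValues_heisenberg.mp hm
  have three_dvd_form : 3 ∣ cubicForm 1 (centralSum v) := by
    refine Int.prime_three.dvd_of_dvd_pow (n := 9) ?_
    exact ((groupDet_heisenberg_modEq v).of_dvd (by norm_num)).dvd_iff.mp h
  have three_dvd_sum : 3 ∣ ∑ x, centralSum v x :=
    (cubicForm_modEq_sum 1 _).dvd_iff.mp three_dvd_form
  have nine_dvd_norm : 9 ∣ (schrodinger cubicChar v).det.norm :=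
    (norm_det_schrodinger_modEq v).dvd_iff.mpr (pow_dvd_pow_of_dvd three_dvd_form 2)
  rw [groupDet_heisenberg_eq_mul_norm, show (3 : ℤ) ^ 12 = 3 ^ 6 * 9 ^ 3 by norm_num]
  exact mul_dvd_mul (pow_six_dvd_groupDet three_dvd_sum) (pow_dvd_pow_of_dvd nine_dvd_norm 3)

theorem groupDet_heisenberg_eq_of_fourier {v : ZMod 3 × ZMod 3 × ZMod 3 → ℤ} {r : ℤ}
    (hA : ∏ k : ZMod 3 × ZMod 3, ∑ x, (centralSum v x : EisensteinInt) *
      (cubicChar (k.1 * x.1) * cubicChar (k.2 * x.2)) = (3 ^ 6 * r : ℤ))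
    (hN : (cubicForm (fun m => cubicChar (-m)) (centralTransform cubicChar v)).norm = 9) :
    groupDet (heisenberg (ZMod 3)) (v ∘ heisenbergEquiv (ZMod 3)) = 3 ^ 12 * r := by
  rw [← groupDet_eq_prod_fourier, Int.cast_inj] at hA
  rw [groupDet_heisenberg_eq_mul_norm, hA, det_schrodinger sum_cubicChar, hN]
  ring

/-- The function equal to `1` on `P`, to `-1` on `N` and to `0` elsewhere. -/
def signedIndicator {ι : Type*} [DecidableEq ι] (P N : Finset ι) (g : ι) : ℤ :=
  (if g ∈ P then 1 else 0) - if g ∈ N then 1 else 0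

theorem exists_groupDet_heisenberg_eq {r : ℤ} (hr : r ∈ ({1, 2, 3, 4, 9} : Finset ℤ)) :
    ∃ v : ZMod 3 × ZMod 3 × ZMod 3 → ℤ, ∑ g, v g = 3 * r ∧
      groupDet (heisenberg (ZMod 3)) (v ∘ heisenbergEquiv (ZMod 3)) = 3 ^ 12 * r := by
  simp only [Finset.mem_insert, Finset.mem_singleton] at hr
  -- The witnesses were found by a computer search.
  obtain rfl | rfl | rfl | rfl | rfl := hr
  · exact ⟨signedIndicator {(0, 1, 0), (0, 2, 2), (1, 0, 2), (1, 1, 2)} {(0, 0, 0)},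
      by decide +kernel, groupDet_heisenberg_eq_of_fourier (by decide +kernel) (by decide +kernel)⟩
  · exact ⟨signedIndicator
      {(0, 0, 1), (0, 1, 1), (0, 2, 1), (1, 0, 0), (1, 0, 1), (2, 2, 1)} ∅,
      by decide +kernel, groupDet_heisenberg_eq_of_fourier (by decide +kernel) (by decide +kernel)⟩
  · exact ⟨signedIndicator
      {(0, 0, 1), (0, 2, 0), (0, 2, 1), (1, 1, 2), (1, 2, 1), (2, 0, 0), (2, 1, 0), (2, 2, 0),
        (2, 2, 2)} ∅,
      by decide +kernel, groupDet_heisenberg_eq_of_fourier (by decide +kernel) (by decide +kernel)⟩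
  · exact ⟨signedIndicator
      {(0, 0, 0), (0, 0, 1), (0, 1, 1), (0, 2, 0), (0, 2, 1), (1, 0, 0), (1, 0, 2), (1, 1, 2),
        (1, 2, 1), (2, 1, 0), (2, 2, 0), (2, 2, 2)} ∅,
      by decide +kernel, groupDet_heisenberg_eq_of_fourier (by decide +kernel) (by decide +kernel)⟩
  · exact ⟨1 + signedIndicator {(1, 0, 2), (1, 2, 1)} {(0, 1, 1), (2, 0, 2)},
      by decide +kernel, groupDet_heisenberg_eq_of_fourier (by decide +kernel) (by decide +kernel)⟩

theorem card_heisenberg_zmod_three : Fintype.card (heisenberg (ZMod 3)) = 27 := by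
  simp [Fintype.card_congr (heisenbergEquiv (ZMod 3)), ZMod.card]

theorem pow_twelve_mul_add_mem_groupDetValues {r : ℤ} (hr : r ∈ ({1, 2, 3, 4, 9} : Finset ℤ))
    (m : ℤ) : 3 ^ 12 * (r + 9 * m) ∈ groupDetValues (heisenberg (ZMod 3)) := by
  obtain ⟨v, sum_v, det_v⟩ := exists_groupDet_heisenberg_eq hr
  have r_ne_zero : r ≠ 0 := by
    rintro rfl
    exact absurd hr (by decide)
  have sum_comp : ∑ g, (v ∘ heisenbergEquiv (ZMod 3)) g = 3 * r :=
    (Equiv.sum_comp _ v).trans sum_v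
  have shifted_det := sum_mul_groupDet_add_const (v ∘ heisenbergEquiv (ZMod 3)) m
  rw [det_v, card_heisenberg_zmod_three, sum_comp] at shifted_det
  refine ⟨_, mul_left_cancel₀ (mul_ne_zero three_ne_zero r_ne_zero) (shifted_det.trans ?_)⟩
  push_cast
  ring

theorem pow_twelve_mul_mem_groupDetValues (k : ℤ) :
    3 ^ 12 * k ∈ groupDetValues (heisenberg (ZMod 3)) := by
  obtain ⟨r, hr, ⟨m, hm⟩ | ⟨m, hm⟩⟩ : ∃ r ∈ ({1, 2, 3, 4, 9} : Finset ℤ),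
      9 ∣ k - r ∨ 9 ∣ -k - r := by
    simp only [Finset.mem_insert, Finset.mem_singleton, exists_eq_or_imp, exists_eq_left]
    lia
  · rw [← add_eq_of_eq_sub' hm.symm]
    exact pow_twelve_mul_add_mem_groupDetValues hr m
  · rw [← neg_neg k, ← add_eq_of_eq_sub' hm.symm, mul_neg]
    exact neg_mem_groupDetValues (card_heisenberg_zmod_three ▸ by decide)
      (pow_twelve_mul_add_mem_groupDetValues hr m)

theorem mem_groupDetValues_of_modEq {m : ℤ} (hm : m ≡ 1 [ZMOD 27] ∨ m ≡ -1 [ZMOD 27]) :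
    m ∈ groupDetValues (heisenberg (ZMod 3)) := by
  have one_add_mem (k : ℤ) := one_add_card_mul_mem_groupDetValues (G := heisenberg (ZMod 3)) k
  rw [card_heisenberg_zmod_three] at one_add_mem
  obtain hm | hm := hm
  · obtain ⟨k, hk⟩ := hm.symm.dvd
    convert one_add_mem k using 1
    lia
  · obtain ⟨k, hk⟩ := hm.dvd
    convert neg_mem_groupDetValues (card_heisenberg_zmod_three ▸ by decide) (one_add_mem k) using 1
    lia

theorem theorem3p5 :
    groupDetValuesOne 3 (heisenberg (ZMod 3)) = {m : ℤ | m ≡ 1 [ZMOD 27] ∨ m ≡ -1 [ZMOD 27]} ∧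
    groupDetValuesZero 3 (heisenberg (ZMod 3)) = {m : ℤ | ∃ k : ℤ, m = 3 ^ 12 * k} := by
  have isCoprime_three {m : ℤ} : IsCoprime m (3 : ℕ) ↔ ¬ 3 ∣ m :=
    isCoprime_comm.trans Int.prime_three.coprime_iff_not_dvd
  constructor <;> ext m
  · constructor
    · rintro ⟨hm, h⟩
      exact modEq_one_or_neg_one_of_mem_groupDetValues hm (isCoprime_three.mp h)
    · intro h
      refine ⟨mem_groupDetValues_of_modEq h, isCoprime_three.mpr ?_⟩
      have hmod : m % 27 = 1 ∨ m % 27 = 26 := h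
      lia
  · constructor
    · rintro ⟨hm, h⟩
      exact pow_twelve_dvd_of_mem_groupDetValues hm h
    · rintro ⟨k, rfl⟩
      exact ⟨pow_twelve_mul_mem_groupDetValues k, Dvd.intro (3 ^ 11 * k) (by push_cast; ring)⟩
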